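/- **Setting.** Let $\mathscr L$ be the algebraic language $\{\wedge,\vee,\cdot,\to,0,1\}$ expanded with a constant symbol $\boldsymbol c_q$ for every $q\in[0,1]\cap\mathbb Q$; formulas are the $\mathscr L$-terms in the variables $x_0,x_1,\dots$. An *MV-algebra* is a member of the variety generated by the standard Łukasiewicz algebra on the real interval $[0,1]$, in which $\wedge,\vee$ are minimum and maximum, $a\cdot b=\max\{0,a+b-1\}$ and $a\to b=\min\{1,1-a+b\}$. A *rational MV-algebra* is an $\mathscr L$-algebra whose $\{\wedge,\vee,\cdot,\to,0,1\}$-reduct is an MV-algebra and which validates the equations $\boldsymbol c_p\cdot\boldsymbol c_q\approx\boldsymbol c_{\max\{0,p+q-1\}}$, $\boldsymbol c_p\to\boldsymbol c_q\approx\boldsymbol c_{\min\{1,1-p+q\}}$, $\boldsymbol c_0\approx 0$, $\boldsymbol c_1\approx 1$ for all $p,q\in[0,1]\cap\mathbb Q$. Let $\mathsf{RMV}$ be the class of rational MV-algebras. *Rational Łukasiewicz logic* $\mathrm{RŁ}$ is given by: $\Gamma\vdash_{\mathrm{RŁ}}\varphi$ iff there is a finite $\Delta\subseteq\Gamma$ such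 that, in every $A\in\mathsf{RMV}$, every assignment giving all $\delta\in\Delta$ the value $1$ also gives $\varphi$ the value $1$. A *logic* is a finitary, substitution-invariant consequence relation on formulas. A logic $\vdash'$ in the same language *extends* $\vdash$ if $\Gamma\vdash\varphi$ implies $\Gamma\vdash'\varphi$; it is *consistent* if not every formula is a theorem. A logic is *structurally complete* if every admissible rule with finitely many premises (one for which every substitution turning all premises into theorems turns the conclusion into a theorem) is derivable, and *hereditarily structurally complete* if all its extensions are structurally complete. A *quasivariety* is a class of algebras axiomatized by quasiequations $(s_1\approx t_1\ \&\ \cdots\ \&\ s_n\approx t_n)\Rightarrow s\approx t$ with $n\ge 0$. It is *nontrivial* if it has a member with more than one element, and *minimal* if it is nontrivial and has no proper nontrivial subquasivariety. **Theorem.** 1. The logic $\mathrm{RŁ}$ is consistent, and it has no proper consistent extension: every consistent logic extending $\mathrm{RŁ}$ is equal to $\mathrm{RŁ}$. 2. $\mathrm{RŁ}$ is hereditarily structurally complete. 3. $\mathsf{RMV}$ is a minimal quasivariety. 4. $\mathsf{RMV}$ is generated as a quasivariety by the algebra on $[0,1]\cap\mathbb Q$ with the above operations in which each $\boldsymbol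 c_q$ is interpreted as $q$. -/

import Mathlib

open FirstOrder FirstOrder.Language CategoryTheory

universe w w'

/-! ### Equations, quasiequations, varieties and quasivarieties -/

namespace FirstOrder.Language

/-- An equation `s ≈ t` between terms in the denumerably many variables `x₀, x₁, …`. -/
structure Equation (L : Language.{0, 0}) where
  lhs : L.Term ℕ
  rhs : L.Term ℕ

/-- A quasiequation `(s₁ ≈ t₁ & … & sₙ ≈ tₙ) ⟹ s ≈ t`; the list of premises may be empty. -/
structure QuasiEquation (L : Language.{0, 0}) where
  premises : List L.Equation
  conclusion : L.Equation

/-- A class of `L`-algebras with carriers in `Type w`. -/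
abbrev AlgClass (L : Language.{0, 0}) := Set (Bundled.{w} L.Structure)

variable {L : Language.{0, 0}}

/-- The equation is true in the algebra `A` under the assignment `v`. -/
def Equation.Realize (e : L.Equation) {A : Type w} [L.Structure A] (v : ℕ → A) : Prop :=
  e.lhs.realize v = e.rhs.realize v

/-- The algebra `A` validates the equation `e`. -/
def Equation.Valid (e : L.Equation) (A : Bundled.{w} L.Structure) : Prop :=
  ∀ v : ℕ → A, e.Realize v

/-- The algebra `A` validates the quasiequation `q`. -/
def QuasiEquation.Valid (q : L.QuasiEquation) (A : Bundled.{w} L.Structure) : Prop :=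
  ∀ v : ℕ → A, (∀ e ∈ q.premises, e.Realize v) → q.conclusion.Realize v

/-- A quasivariety: a class of algebras axiomatized by a set of quasiequations. -/
def IsQuasivariety (K : AlgClass.{w} L) : Prop :=
  ∃ Φ : Set L.QuasiEquation, K = {A | ∀ q ∈ Φ, q.Valid A}

/-- The variety generated by `K`: all algebras validating every equation that is valid in `K`. The
generated class may be taken in a universe different from that of `K`. -/
def genVariety (K : AlgClass.{w} L) : AlgClass.{w'} L :=
  {A | ∀ e : L.Equation, (∀ B ∈ K, e.Valid B) → e.Valid A}

/-- The quasivariety generated by `K`: all algebras validating every quasiequation that is valid in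
`K`. The generated class may be taken in a universe different from that of `K`. -/
def genQuasivariety (K : AlgClass.{w} L) : AlgClass.{w'} L :=
  {A | ∀ q : L.QuasiEquation, (∀ B ∈ K, q.Valid B) → q.Valid A}

/-- `genQuasivariety K` is the smallest quasivariety containing `K`. -/
theorem isLeast_genQuasivariety (K : AlgClass.{w} L) :
    IsLeast {M : AlgClass.{w} L | IsQuasivariety M ∧ K ⊆ M} (genQuasivariety K) := by
  refine ⟨⟨⟨{q | ∀ B ∈ K, q.Valid B}, rfl⟩, fun A hA q hq => hq A hA⟩, ?_⟩
  rintro M ⟨⟨Φ, rfl⟩, hK⟩ A hA q hq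
  exact hA q fun B hB => hK hB q hq

/-- A class of algebras is nontrivial if it has a member with at least two elements. -/
def IsNontrivialClass (K : AlgClass.{w} L) : Prop :=
  ∃ A ∈ K, Nontrivial A

/-- A minimal quasivariety: a nontrivial quasivariety with no nontrivial proper subquasivariety. -/
def IsMinimalQuasivariety (K : AlgClass.{w} L) : Prop :=
  IsQuasivariety K ∧ IsNontrivialClass K ∧
    ∀ M : AlgClass.{w} L, IsQuasivariety M → M ⊆ K → IsNontrivialClass M → M = K

/-- The equational consequence relation relative to the class `K`. -/
def EqConsequence (K : AlgClass.{w} L) (Θ : Set L.Equation) (e : L.Equation) : Prop :=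
  ∀ A ∈ K, ∀ v : ℕ → A, (∀ d ∈ Θ, d.Realize v) → e.Realize v

/-! ### Propositional logics and structural completeness -/

/-- A (finitary) propositional logic in the algebraic language `L`: a finitary, substitution
invariant consequence relation on the formulas (terms) in the variables `x₀, x₁, …`. -/
@[ext]
structure PropLogic (L : Language.{0, 0}) where
  Entails : Set (L.Term ℕ) → L.Term ℕ → Prop
  refl : ∀ Γ φ, φ ∈ Γ → Entails Γ φ
  cut : ∀ Γ Δ φ, (∀ δ ∈ Δ, Entails Γ δ) → Entails Δ φ → Entails Γ φ
  subst_invariant : ∀ (σ : ℕ → L.Term ℕ) Γ φ, Entails Γ φ →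
    Entails ((fun γ => γ.subst σ) '' Γ) (φ.subst σ)
  finitary : ∀ Γ φ, Entails Γ φ → ∃ Δ ⊆ Γ, Δ.Finite ∧ Entails Δ φ

/-- `l'` is an extension of `l` (in the same language). -/
def PropLogic.IsExtension (l' l : PropLogic L) : Prop :=
  ∀ Γ φ, l.Entails Γ φ → l'.Entails Γ φ

/-- A logic is consistent if not every formula is a theorem. -/
def PropLogic.Consistent (l : PropLogic L) : Prop :=
  ∃ φ, ¬ l.Entails ∅ φ

/-- The rule `Γ ▹ φ` is admissible in `l`: every substitution that turns all the premises into
theorems turns the conclusion into a theorem. -/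
def PropLogic.Admissible (l : PropLogic L) (Γ : Set (L.Term ℕ)) (φ : L.Term ℕ) : Prop :=
  ∀ σ : ℕ → L.Term ℕ, (∀ γ ∈ Γ, l.Entails ∅ (γ.subst σ)) → l.Entails ∅ (φ.subst σ)

/-- Structural completeness: every admissible rule (with finitely many premises) is derivable. -/
def PropLogic.StructurallyComplete (l : PropLogic L) : Prop :=
  ∀ (Γ : Set (L.Term ℕ)) (φ : L.Term ℕ), Γ.Finite → l.Admissible Γ φ → l.Entails Γ φ

/-- Hereditary structural completeness: all extensions are structurally complete. -/
def PropLogic.HereditarilyStructurallyComplete (l : PropLogic L) : Prop :=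
  ∀ l' : PropLogic L, l'.IsExtension l → l'.StructurallyComplete

end FirstOrder.Language

/-! ### Rational MV-algebras and rational Łukasiewicz logic -/

namespace RatLuk

/-- The basic operation symbols `∧, ∨, ·, →, 0, 1` of BL-algebras. -/
inductive BLFunc : ℕ → Type
  | zero : BLFunc 0
  | one : BLFunc 0
  | inf : BLFunc 2
  | sup : BLFunc 2
  | mul : BLFunc 2
  | imp : BLFunc 2

/-- The algebraic language of BL-algebras. -/
def BL : FirstOrder.Language.{0, 0} := ⟨BLFunc, fun _ => Empty⟩

/-- The index set `[0, 1] ∩ ℚ` of the truth constants. -/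
abbrev RatUnit := Set.Icc (0 : ℚ) 1

/-- The language of BL-algebras expanded with a constant `c_q` for every rational `q ∈ [0, 1]`. -/
abbrev RL : FirstOrder.Language.{0, 0} := BL[[RatUnit]]

section Standard

variable {𝕜 : Type w} [Field 𝕜] [LinearOrder 𝕜] [IsStrictOrderedRing 𝕜]

/-- The Łukasiewicz t-norm `max {0, a + b - 1}`. -/
def lukMul (a b : Set.Icc (0 : 𝕜) 1) : Set.Icc (0 : 𝕜) 1 :=
  ⟨max 0 (a + b - 1), le_max_left _ _, max_le zero_le_one (by linarith [a.2.2, b.2.2])⟩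

/-- The residuum `min {1, 1 - a + b}` of the Łukasiewicz t-norm. -/
def lukImp (a b : Set.Icc (0 : 𝕜) 1) : Set.Icc (0 : 𝕜) 1 :=
  ⟨min 1 (1 - a + b), le_min zero_le_one (by linarith [a.2.2, b.2.1]), min_le_left _ _⟩

/-- `lukImp a c` is the largest `b` with `lukMul b a ≤ c`. -/
theorem isGreatest_lukImp (a c : Set.Icc (0 : 𝕜) 1) :
    IsGreatest {b | lukMul b a ≤ c} (lukImp a c) := by
  have ha := a.2.2
  have hc := c.2.1
  refine ⟨?_, fun b hb => ?_⟩
  · change max 0 (min 1 (1 - (a : 𝕜) + c) + a - 1) ≤ (c : 𝕜)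
    exact max_le hc (by linarith [min_le_right 1 (1 - (a : 𝕜) + c)])
  · change (b : 𝕜) ≤ min 1 (1 - (a : 𝕜) + c)
    have hb' : max 0 ((b : 𝕜) + a - 1) ≤ c := hb
    exact le_min b.2.2 (by linarith [le_max_right 0 ((b : 𝕜) + a - 1)])

variable (𝕜)

/-- The Łukasiewicz algebra `⟨[0, 1]; ∧, ∨, ·, →, 0, 1⟩` on the unit interval of `𝕜`. -/
@[reducible]
def lukStructure : BL.Structure (Set.Icc (0 : 𝕜) 1) where
  funMap {n} f :=
    match n, f with
    | _, BLFunc.zero => fun _ => ⟨0, le_rfl, zero_le_one⟩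
    | _, BLFunc.one => fun _ => ⟨1, zero_le_one, le_rfl⟩
    | _, BLFunc.inf => fun x => x 0 ⊓ x 1
    | _, BLFunc.sup => fun x => x 0 ⊔ x 1
    | _, BLFunc.mul => fun x => lukMul (x 0) (x 1)
    | _, BLFunc.imp => fun x => lukImp (x 0) (x 1)
  RelMap {_} r := Empty.elim r

/-- The Łukasiewicz algebra on the unit interval of `𝕜`, where `c_q` is interpreted as `q`. -/
@[reducible]
def ratLukStructure : RL.Structure (Set.Icc (0 : 𝕜) 1) :=
  letI := lukStructure 𝕜
  letI := constantsOn.structure (α := RatUnit) (M := Set.Icc (0 : 𝕜) 1)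
    fun q => ⟨((q : ℚ) : 𝕜), by exact_mod_cast q.2.1, by exact_mod_cast q.2.2⟩
  inferInstanceAs ((BL.sum (constantsOn RatUnit)).Structure (Set.Icc (0 : 𝕜) 1))

end Standard

/-- The standard Łukasiewicz algebra on the real unit interval. -/
noncomputable def standardLuk : Bundled.{0} BL.Structure := ⟨Set.Icc (0 : ℝ) 1, lukStructure ℝ⟩

/-- The rational algebra on `[0, 1] ∩ ℚ`, with the constants interpreted naturally. -/
def rationalLukQ : Bundled.{0} RL.Structure := ⟨Set.Icc (0 : ℚ) 1, ratLukStructure ℚ⟩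

/-- The variety of MV-algebras (in the language of BL-algebras), generated by the standard
Łukasiewicz algebra. -/
def MV : AlgClass.{w} BL := genVariety {standardLuk}

/-- The BL-reduct of an algebra in the language with rational constants. -/
def blReduct (A : Bundled.{w} RL.Structure) : Bundled.{w} BL.Structure :=
  ⟨A, (BL.lhomWithConstants RatUnit).reduct A⟩

/-- The term `c_q`. -/
def cTerm (q : RatUnit) : RL.Term ℕ := (BL.con q).term

/-- The term `0`. -/
def zeroTerm : RL.Term ℕ := Term.func (L := RL) (Sum.inl BLFunc.zero : RL.Functions 0) ![]

/-- The term `1`. -/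
def oneTerm : RL.Term ℕ := Term.func (L := RL) (Sum.inl BLFunc.one : RL.Functions 0) ![]

/-- The term `s · t`. -/
def mulTerm (s t : RL.Term ℕ) : RL.Term ℕ := Term.func (L := RL) (Sum.inl BLFunc.mul : RL.Functions 2) ![s, t]

/-- The term `s → t`. -/
def impTerm (s t : RL.Term ℕ) : RL.Term ℕ := Term.func (L := RL) (Sum.inl BLFunc.imp : RL.Functions 2) ![s, t]

/-- The bookkeeping axioms of the standard Łukasiewicz algebra. -/
inductive Bookkeeping : RL.Equation → Prop
  | mul (p q : RatUnit) : Bookkeeping ⟨mulTerm (cTerm p) (cTerm q), cTerm (lukMul p q)⟩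
  | imp (p q : RatUnit) : Bookkeeping ⟨impTerm (cTerm p) (cTerm q), cTerm (lukImp p q)⟩
  | zero : Bookkeeping ⟨cTerm ⟨0, le_rfl, zero_le_one⟩, zeroTerm⟩
  | one : Bookkeeping ⟨cTerm ⟨1, zero_le_one, le_rfl⟩, oneTerm⟩

/-- The class of rational MV-algebras. -/
def RMV : AlgClass.{w} RL :=
  {A | blReduct A ∈ MV.{w} ∧ ∀ e : RL.Equation, Bookkeeping e → e.Valid A}

/-- The translation `τ` of a formula `φ` into the equation `φ ≈ 1`. -/
def tau (φ : RL.Term ℕ) : RL.Equation := ⟨φ, oneTerm⟩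

theorem realize_tau_subst (σ : ℕ → RL.Term ℕ) (φ : RL.Term ℕ) {A : Type w} [RL.Structure A]
    (v : ℕ → A) : (tau (φ.subst σ)).Realize v ↔ (tau φ).Realize fun n => (σ n).realize v := by
  have h : oneTerm.realize v = oneTerm.realize fun n => (σ n).realize v := by
    simp only [oneTerm, Term.realize]
    congr 1
    funext i
    exact i.elim0
  simp only [Equation.Realize, tau, Term.realize_subst, h]

/-- Rational Łukasiewicz logic. -/
def RLuk : PropLogic RL where
  Entails Γ φ := ∃ Δ ⊆ Γ, Δ.Finite ∧ EqConsequence RMV.{0} (tau '' Δ) (tau φ)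
  refl Γ φ h := ⟨{φ}, by simpa using h, Set.finite_singleton φ, fun A _ v hv =>
    hv _ ⟨φ, rfl, rfl⟩⟩
  cut := by
    rintro Γ Δ φ h ⟨Θ, hΘ, hfin, hc⟩
    choose! D hD hDfin hDc using h
    refine ⟨⋃ θ ∈ Θ, D θ, Set.iUnion₂_subset fun θ hθ => hD θ (hΘ hθ),
      hfin.biUnion fun θ hθ => hDfin θ (hΘ hθ), fun A hA v hv => hc A hA v ?_⟩
    rintro _ ⟨θ, hθ, rfl⟩
    refine hDc θ (hΘ hθ) A hA v ?_
    rintro _ ⟨δ, hδ, rfl⟩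
    exact hv _ ⟨δ, Set.mem_biUnion hθ hδ, rfl⟩
  subst_invariant := by
    rintro σ Γ φ ⟨Δ, hΔ, hfin, hc⟩
    refine ⟨_, Set.image_mono hΔ, hfin.image _, fun A hA v hv => ?_⟩
    rw [realize_tau_subst]
    refine hc A hA _ ?_
    rintro _ ⟨δ, hδ, rfl⟩
    rw [← realize_tau_subst]
    exact hv _ ⟨_, ⟨δ, hδ, rfl⟩, rfl⟩
  finitary := by
    rintro Γ φ ⟨Δ, hΔ, hfin, hc⟩
    exact ⟨Δ, hΔ, hfin, Δ, subset_rfl, hfin, hc⟩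

end RatLuk

/-! ### Farkas' lemma -/

/-! Everything follows from one fact: every nontrivial rational MV-algebra has the same valid
quasiequations as the rational algebra on `[0, 1] ∩ ℚ`.

One direction is an embedding. By the bookkeeping axioms, `q ↦ c_q` is a homomorphism from the
rational algebra. If it identified two constants, some `c_r` with `r < 1` would equal `1`; a power
of `r` is `0`, so `0 = 1` and the algebra would be trivial.

The other direction must pass from equations to quasiequations, since MV-algebras are only given as
a variety. Term functions are piecewise affine with rational coefficients. If vanishing of all
premise distances `|sᵢ - tᵢ|` forces `|s - t| = 0` at rational points, then Farkas' lemma on each of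
finitely many cells gives `|s - t| ≤ n ∑ |sᵢ - tᵢ|` on the real cube (`exists_sub_le_mul_sum`). This
bound is expressible by equations, which hold in all MV-algebras and imply the quasiequation
(`MV.quasiEquation_valid`). Constants are eliminated beforehand: with a common denominator `N`, they
become multiples of a new variable that an extra premise forces to be `1 / N`.

On the side of logic, assignments into the rational algebra are substitutions of constants
(`RLuk_theorem_subst_constants`). So a rule refuted there is not admissible, and an extension
deriving it proves a closed formula of value below `1`, from which everything follows. -/

theorem exists_nonneg_combination_of_forall_nonneg {K V ι : Type*} [Field K] [LinearOrder K]
    [IsStrictOrderedRing K] [AddCommGroup V] [Module K V] (s : Finset ι)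
    (A : ι → Module.Dual K V) (b : Module.Dual K V)
    (h : ∀ x, (∀ i ∈ s, 0 ≤ A i x) → 0 ≤ b x) :
    ∃ c : ι → K, (∀ i, 0 ≤ c i) ∧ b = ∑ i ∈ s, c i • A i := by
  classical
  induction s using Finset.induction_on generalizing A b with
  | empty =>
    refine ⟨0, fun _ => le_rfl, ?_⟩
    ext x
    have h1 := h x (by simp)
    have h2 := h (-x) (by simp)
    rw [map_neg] at h2
    simpa using le_antisymm (by linarith) h1
  | insert j s hj ih =>
    by_cases hs : ∀ x, (∀ i ∈ s, 0 ≤ A i x) → 0 ≤ b x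
    · obtain ⟨c, hc, rfl⟩ := ih A b hs
      refine ⟨Function.update c j 0, fun i => ?_, ?_⟩
      · by_cases hi : i = j
        · simp [hi]
        · simpa [hi] using hc i
      · rw [Finset.sum_insert hj, Function.update_self, zero_smul, zero_add]
        refine Finset.sum_congr rfl fun i hi => ?_
        rw [Function.update_of_ne (by rintro rfl; exact hj hi)]
    -- Here `A j` is really needed: some `y` satisfies the constraints in `s` but has `b y < 0`, so
    -- `A j y < 0`, and `y` can be rescaled to `z` with `A j z = -1`.
    · push Not at hs
      obtain ⟨y, hy, hby⟩ := hs
      have hjy : A j y < 0 := by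
        by_contra hcon
        exact absurd (h y (by simpa [hy] using ⟨not_lt.mp hcon, hy⟩)) (not_le.mpr hby)
      obtain ⟨z, hz, hbz, hjz⟩ : ∃ z, (∀ i ∈ s, 0 ≤ A i z) ∧ b z ≤ 0 ∧ A j z = -1 := by
        have hpos : 0 ≤ (-A j y)⁻¹ := inv_nonneg.mpr (by linarith)
        refine ⟨(-A j y)⁻¹ • y, fun i hi => ?_, ?_, ?_⟩
        · simpa using mul_nonneg hpos (hy i hi)
        · simpa using mul_nonpos_of_nonneg_of_nonpos hpos hby.le
        · have : A j y ≠ 0 := hjy.ne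
          simp [inv_neg, this]
      -- The map `x ↦ x + A j x • z` projects onto the kernel of `A j`. Composing all forms with it
      -- removes the constraint `A j`, and the induction hypothesis applies.
      obtain ⟨c, hc, hb⟩ := ih (fun i => A i + A i z • A j) (b + b z • A j) (fun x hx => by
        have := h (x + A j x • z) (fun i hi => by
          rcases Finset.mem_insert.mp hi with rfl | hi
          · simp [hjz]
          · have := hx i hi
            simp only [LinearMap.add_apply, LinearMap.smul_apply, smul_eq_mul] at this
            simp only [map_add, map_smul, smul_eq_mul]
            linarith)
        simp only [map_add, map_smul, smul_eq_mul] at this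
        simp only [LinearMap.add_apply, LinearMap.smul_apply, smul_eq_mul]
        linarith)
      have hsum : 0 ≤ ∑ i ∈ s, c i * A i z :=
        Finset.sum_nonneg fun i hi => mul_nonneg (hc i) (hz i hi)
      -- Solving the identity `hb` for `b` gives this coefficient of `A j`; it is nonnegative
      -- because `A i z ≥ 0` and `b z ≤ 0`.
      refine ⟨Function.update c j (∑ i ∈ s, c i * A i z - b z), fun i => ?_, ?_⟩
      · by_cases hi : i = j
        · subst hi
          simp only [Function.update_self]
          linarith
        · simpa [hi] using hc i
      · have h1 : ∑ i ∈ s, Function.update c j (∑ i ∈ s, c i * A i z - b z) i • A i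
            = ∑ i ∈ s, c i • A i := by
          refine Finset.sum_congr rfl fun i hi => ?_
          rw [Function.update_of_ne (by rintro rfl; exact hj hi)]
        rw [Finset.sum_insert hj, Function.update_self, h1]
        ext x
        have hbx := LinearMap.congr_fun hb x
        simp only [LinearMap.add_apply, LinearMap.smul_apply, smul_eq_mul, LinearMap.sum_apply,
          mul_add, Finset.sum_add_distrib] at hbx ⊢
        have h2 : ∑ i ∈ s, c i * (A i z * A j x) = (∑ i ∈ s, c i * A i z) * A j x := by
          rw [Finset.sum_mul]
          exact Finset.sum_congr rfl fun i _ => by ring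
        rw [h2] at hbx
        linarith

/-! ### Piecewise linear functions on the rational and the real unit cube -/

namespace RatLuk

/-- The homogenized point `(1, x)` of a point `x` of the unit cube. -/
def homogenize {𝕜 : Type*} [Field 𝕜] [LinearOrder 𝕜] (x : ℕ → Set.Icc (0 : 𝕜) 1) : Option ℕ → 𝕜
  | none => 1
  | some i => x i

/-- The value of an affine form with rational coefficients at a point of the unit cube. -/
noncomputable def affineEval {𝕜 : Type*} [Field 𝕜] [LinearOrder 𝕜] [IsStrictOrderedRing 𝕜]
    (x : ℕ → Set.Icc (0 : 𝕜) 1) : (Option ℕ →₀ ℚ) →ₗ[ℚ] 𝕜 :=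
  Finsupp.linearCombination ℚ (homogenize x)

/-- `f` and `g` are the rational and the real version of one piecewise affine function: there are
finitely many cells with an affine form each, such that the forms describe `f` on the rational
points of their cells, and every real point lies in a cell whose form describes `g` there. -/
def IsPiecewiseAffine (f : (ℕ → Set.Icc (0 : ℚ) 1) → ℚ) (g : (ℕ → Set.Icc (0 : ℝ) 1) → ℝ) : Prop :=
  ∃ P : List (List (Option ℕ →₀ ℚ) × (Option ℕ →₀ ℚ)),
    (∀ p ∈ P, ∀ x, (∀ c ∈ p.1, 0 ≤ affineEval x c) → f x = affineEval x p.2) ∧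
    ∀ x, ∃ p ∈ P, (∀ c ∈ p.1, 0 ≤ affineEval x c) ∧ g x = affineEval x p.2

namespace IsPiecewiseAffine

variable {f f' : (ℕ → Set.Icc (0 : ℚ) 1) → ℚ} {g g' : (ℕ → Set.Icc (0 : ℝ) 1) → ℝ}

theorem affine (a : Option ℕ →₀ ℚ) :
    IsPiecewiseAffine (fun x => affineEval x a) (fun x => affineEval x a) :=
  ⟨[([], a)], by simp, by simp⟩

theorem coord (i : ℕ) : IsPiecewiseAffine (fun x => x i) (fun x => x i) := by
  simpa [affineEval, homogenize] using affine (Finsupp.single (some i) 1)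

theorem const (q : ℚ) : IsPiecewiseAffine (fun _ => q) (fun _ => q) := by
  simpa [affineEval, homogenize, Rat.smul_def] using affine (Finsupp.single none q)

theorem add (h : IsPiecewiseAffine f g) (h' : IsPiecewiseAffine f' g') :
    IsPiecewiseAffine (fun x => f x + f' x) (fun x => g x + g' x) := by
  obtain ⟨P, hP, hP'⟩ := h
  obtain ⟨R, hR, hR'⟩ := h'
  refine ⟨P.flatMap fun p => R.map fun r => (p.1 ++ r.1, p.2 + r.2), ?_, fun x => ?_⟩
  · simp only [List.mem_flatMap, List.mem_map]
    rintro _ ⟨p, hp, r, hr, rfl⟩ x hx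
    simp only [List.mem_append] at hx
    rw [hP p hp x fun c hc => hx c (.inl hc), hR r hr x fun c hc => hx c (.inr hc), map_add]
  · obtain ⟨p, hp, hpx, hgp⟩ := hP' x
    obtain ⟨r, hr, hrx, hgr⟩ := hR' x
    refine ⟨_, List.mem_flatMap.mpr ⟨p, hp, List.mem_map.mpr ⟨r, hr, rfl⟩⟩, ?_, ?_⟩
    · simp only [List.mem_append]
      rintro c (hc | hc)
      exacts [hpx c hc, hrx c hc]
    · simp only [hgp, hgr, map_add]

theorem neg (h : IsPiecewiseAffine f g) : IsPiecewiseAffine (fun x => -f x) (fun x => -g x) := by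
  obtain ⟨P, hP, hP'⟩ := h
  refine ⟨P.map fun p => (p.1, -p.2), ?_, fun x => ?_⟩
  · simp only [List.mem_map]
    rintro _ ⟨p, hp, rfl⟩ x hx
    simp only [map_neg, hP p hp x hx]
  · obtain ⟨p, hp, hpx, hgp⟩ := hP' x
    exact ⟨_, List.mem_map.mpr ⟨p, hp, rfl⟩, hpx, by simp only [map_neg, hgp]⟩

theorem sub (h : IsPiecewiseAffine f g) (h' : IsPiecewiseAffine f' g') :
    IsPiecewiseAffine (fun x => f x - f' x) (fun x => g x - g' x) := by
  simpa only [sub_eq_add_neg] using h.add h'.neg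

/-- Each intersection of two cells is cut in two by the hyperplane where the two affine forms agree.
-/
theorem max (h : IsPiecewiseAffine f g) (h' : IsPiecewiseAffine f' g') :
    IsPiecewiseAffine (fun x => Max.max (f x) (f' x)) (fun x => Max.max (g x) (g' x)) := by
  obtain ⟨P, hP, hP'⟩ := h
  obtain ⟨R, hR, hR'⟩ := h'
  refine ⟨P.flatMap fun p => R.flatMap fun r =>
    [((p.2 - r.2) :: (p.1 ++ r.1), p.2), ((r.2 - p.2) :: (p.1 ++ r.1), r.2)], ?_, fun x => ?_⟩
  · simp only [List.mem_flatMap, List.mem_cons, List.not_mem_nil, or_false]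
    rintro _ ⟨p, hp, r, hr, rfl | rfl⟩ x hx <;>
    · simp only [List.mem_cons, List.mem_append, forall_eq_or_imp, map_sub, sub_nonneg] at hx
      rw [hP p hp x fun c hc => hx.2 c (.inl hc), hR r hr x fun c hc => hx.2 c (.inr hc)]
      simpa using hx.1
  · obtain ⟨p, hp, hpx, hgp⟩ := hP' x
    obtain ⟨r, hr, hrx, hgr⟩ := hR' x
    have hc : ∀ c ∈ p.1 ++ r.1, 0 ≤ affineEval x c := by
      simp only [List.mem_append]
      rintro c (hc | hc)
      exacts [hpx c hc, hrx c hc]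
    simp only [List.mem_flatMap]
    rcases le_total (g x) (g' x) with hle | hle
    · refine ⟨_, ⟨p, hp, r, hr, List.mem_cons_of_mem _ List.mem_cons_self⟩, ?_, ?_⟩
      · simpa only [List.forall_mem_cons, map_sub, sub_nonneg, ← hgp, ← hgr] using ⟨hle, hc⟩
      · rw [max_eq_right hle, hgr]
    · refine ⟨_, ⟨p, hp, r, hr, List.mem_cons_self⟩, ?_, ?_⟩
      · simpa only [List.forall_mem_cons, map_sub, sub_nonneg, ← hgp, ← hgr] using ⟨hle, hc⟩
      · rw [max_eq_left hle, hgp]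

theorem min (h : IsPiecewiseAffine f g) (h' : IsPiecewiseAffine f' g') :
    IsPiecewiseAffine (fun x => Min.min (f x) (f' x)) (fun x => Min.min (g x) (g' x)) := by
  simpa only [max_neg_neg, neg_neg] using (h.neg.max h'.neg).neg

theorem abs (h : IsPiecewiseAffine f g) : IsPiecewiseAffine (fun x => |f x|) (fun x => |g x|) :=
  h.max h.neg

theorem list_sum {α : Type*} {F : α → (ℕ → Set.Icc (0 : ℚ) 1) → ℚ}
    {G : α → (ℕ → Set.Icc (0 : ℝ) 1) → ℝ} (l : List α) (h : ∀ a ∈ l, IsPiecewiseAffine (F a) (G a)) :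
    IsPiecewiseAffine (fun x => (l.map fun a => F a x).sum) (fun x => (l.map fun a => G a x).sum) := by
  induction l with
  | nil => simpa using const 0
  | cons a l ih =>
    simp only [List.map_cons, List.sum_cons]
    exact (h a List.mem_cons_self).add (ih fun b hb => h b (List.mem_cons_of_mem _ hb))

end IsPiecewiseAffine

/-- On a cell of the cube, an affine form `b` that is nonpositive at the rational zeros of a form
`a` is dominated by a multiple of `a` wherever `a` is nonnegative. -/
theorem exists_affineEval_le_mul (C : List (Option ℕ →₀ ℚ)) (a b : Option ℕ →₀ ℚ)
    (h : ∀ x : ℕ → Set.Icc (0 : ℚ) 1, (∀ c ∈ C, 0 ≤ affineEval x c) → affineEval x a ≤ 0 →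
      affineEval x b ≤ 0) :
    ∃ r : ℝ, ∀ x : ℕ → Set.Icc (0 : ℝ) 1, (∀ c ∈ C, 0 ≤ affineEval x c) → 0 ≤ affineEval x a →
      affineEval x b ≤ r * affineEval x a := by
  classical
  let F : Finset (Option ℕ →₀ ℚ) := insert (-a) (insert b C.toFinset)
  let S : Finset (Option ℕ) := insert none (F.biUnion Finsupp.support)
  -- Homogenized cube constraints `0 ≤ yᵢ ≤ y_none`, for the finitely many coordinates that occur.
  -- Together with `C` and `a ≤ 0` they are the hypotheses for Farkas' lemma, with conclusion `b ≤
  -- 0`.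
  let B : Finset (Option ℕ →₀ ℚ) := S.image (fun i => Finsupp.single i 1) ∪
    S.image (fun i => Finsupp.single none 1 - Finsupp.single i 1)
  let T : Finset (Option ℕ →₀ ℚ) := insert (-a) (C.toFinset ∪ B)
  let ev : (Option ℕ →₀ ℚ) → Module.Dual ℚ (Option ℕ → ℚ) := fun c =>
    ∑ i ∈ c.support, c i • LinearMap.proj i
  have hev : ∀ c y, ev c y = Finsupp.linearCombination ℚ y c := fun c y => by
    simp [ev, Finsupp.linearCombination_apply, Finsupp.sum]
  obtain ⟨l, hl, hb⟩ := exists_nonneg_combination_of_forall_nonneg T ev (ev (-b)) (by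
    intro y hy
    simp only [T, B, Finset.mem_insert, Finset.mem_union, Finset.mem_image, List.mem_toFinset,
      hev] at hy ⊢
    have hy0 : ∀ i ∈ S, 0 ≤ y i := fun i hi => by
      simpa using hy _ (.inr (.inr (.inl ⟨i, hi, rfl⟩)))
    have hy1 : ∀ i ∈ S, y i ≤ y none := fun i hi => by
      simpa [map_sub] using hy _ (.inr (.inr (.inr ⟨i, hi, rfl⟩)))
    have hn : none ∈ S := Finset.mem_insert_self _ _
    have hsup : ∀ c ∈ F, ∀ i ∈ c.support, i ∈ S := fun c hc i hi =>
      Finset.mem_insert_of_mem (Finset.mem_biUnion.mpr ⟨c, hc, hi⟩)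
    have hbF : b ∈ F := by simp [F]
    -- If `y none = 0`, the cube constraints kill every relevant coordinate, so `b` vanishes at `y`.
    -- Otherwise division by `y none` gives a point of the rational cube.
    rcases (hy0 none hn).eq_or_lt with h0 | hpos
    · rw [map_neg, Finsupp.linearCombination_apply, Finsupp.sum, Finset.sum_eq_zero, neg_zero]
      intro i hi
      have : y i = 0 := le_antisymm (by simpa [← h0] using hy1 i (hsup b hbF i hi))
        (hy0 i (hsup b hbF i hi))
      simp [this]
    · let x : ℕ → Set.Icc (0 : ℚ) 1 := fun i =>
        if hi : some i ∈ S then ⟨y (some i) / y none, div_nonneg (hy0 _ hi) hpos.le,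
          (div_le_one hpos).mpr (hy1 _ hi)⟩ else ⟨0, le_rfl, zero_le_one⟩
      have hx : ∀ c ∈ F, affineEval x c = Finsupp.linearCombination ℚ y c / y none := by
        intro c hc
        simp only [affineEval, Finsupp.linearCombination_apply, Finsupp.sum, Finset.sum_div]
        refine Finset.sum_congr rfl fun i hi => ?_
        have hiS := hsup c hc i hi
        cases i with
        | none => simp [homogenize, hpos.ne']
        | some i => simp [homogenize, x, hiS, mul_div_assoc]
      have haF : -a ∈ F := by simp [F]
      have key := h x (fun c hc => by
          rw [hx c (by simp [F, hc])]
          exact div_nonneg (hy c (.inr (.inl hc))) hpos.le) (by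
          have h1 := hx _ haF
          have h2 := div_nonneg (hy (-a) (.inl rfl)) hpos.le
          rw [← h1, map_neg] at h2
          linarith)
      rw [hx b hbF, div_le_iff₀ hpos, zero_mul] at key
      rw [map_neg]
      linarith)
  -- Evaluation at unit vectors turns the identity of functionals over `ℚ` into one of coefficients,
  -- which can then be evaluated at real points.
  have hb' : -b = ∑ c ∈ T, l c • c := by
    ext i
    have := LinearMap.congr_fun hb (Pi.single i 1)
    have hs : ∀ c : Option ℕ →₀ ℚ, ev c (Pi.single i 1) = c i := fun c => by
      rw [hev, Finsupp.linearCombination_apply, Finsupp.sum]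
      simpa [Pi.single_apply] using Eq.symm
    rw [hs] at this
    simpa [LinearMap.sum_apply, Finsupp.finsetSum_apply, hs] using this
  -- Every form in `T` is at least `-a` at `x`: one of them is `-a`, and the others are nonnegative.
  -- So the total weight of the combination serves as the multiplier.
  refine ⟨((∑ c ∈ T, l c : ℚ) : ℝ), fun x hC ha => ?_⟩
  have h1 : -affineEval x b = ∑ c ∈ T, (l c : ℝ) * affineEval x c := by
    rw [← map_neg, hb', map_sum]
    exact Finset.sum_congr rfl fun c _ => by rw [map_smul, Rat.smul_def]
  have h2 : ∑ c ∈ T, (l c : ℝ) * (-affineEval x a) ≤ ∑ c ∈ T, (l c : ℝ) * affineEval x c := by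
    refine Finset.sum_le_sum fun c hc => mul_le_mul_of_nonneg_left ?_ (by exact_mod_cast hl c)
    simp only [T, B, Finset.mem_insert, Finset.mem_union, Finset.mem_image, List.mem_toFinset] at hc
    rcases hc with rfl | hc | ⟨i, -, rfl⟩ | ⟨i, -, rfl⟩
    · rw [map_neg]
    · linarith [hC c hc]
    · refine (neg_nonpos.mpr ha).trans ?_
      cases i with
      | none => simp [affineEval, homogenize]
      | some i => simpa [affineEval, homogenize] using (x i).2.1
    · refine (neg_nonpos.mpr ha).trans ?_
      cases i with
      | none => simp [affineEval]
      | some i => simpa [affineEval, homogenize] using (x i).2.2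
  rw [← h1, ← Finset.sum_mul] at h2
  push_cast
  linarith

/-- A Łojasiewicz inequality with exponent one: there are finitely many pairs of cells, each with
its own multiplier, and `n` bounds them all. The hypothesis concerns rational points, the bound real
ones. -/
theorem IsPiecewiseAffine.exists_le_nat_mul {f f' : (ℕ → Set.Icc (0 : ℚ) 1) → ℚ}
    {g g' : (ℕ → Set.Icc (0 : ℝ) 1) → ℝ} (h : IsPiecewiseAffine f g)
    (h' : IsPiecewiseAffine f' g') (hg : ∀ x, 0 ≤ g x) (hff' : ∀ x, f x ≤ 0 → f' x ≤ 0) :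
    ∃ n : ℕ, ∀ x, g' x ≤ n * g x := by
  obtain ⟨P, hP, hP'⟩ := h
  obtain ⟨R, hR, hR'⟩ := h'
  have key : ∀ p ∈ P, ∀ r ∈ R, ∃ t : ℝ, ∀ x : ℕ → Set.Icc (0 : ℝ) 1,
      (∀ c ∈ p.1 ++ r.1, 0 ≤ affineEval x c) → 0 ≤ affineEval x p.2 →
      affineEval x r.2 ≤ t * affineEval x p.2 := fun p hp r hr =>
    exists_affineEval_le_mul _ _ _ fun x hx h0 => by
      simp only [List.mem_append] at hx
      rw [← hR r hr x fun c hc => hx c (.inr hc)]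
      rw [← hP p hp x fun c hc => hx c (.inl hc)] at h0
      exact hff' x h0
  choose! t ht using key
  let s := (P.flatMap fun p => R.map fun r => |t p r|).sum
  obtain ⟨n, hn⟩ := exists_nat_ge s
  refine ⟨n, fun x => ?_⟩
  obtain ⟨p, hp, hpx, hgp⟩ := hP' x
  obtain ⟨r, hr, hrx, hgr⟩ := hR' x
  have h0 := hg x
  have hle : |t p r| ≤ s := by
    refine List.single_le_sum ?_ _ (List.mem_flatMap.mpr ⟨p, hp, List.mem_map.mpr ⟨r, hr, rfl⟩⟩)
    simp only [List.mem_flatMap, List.mem_map]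
    rintro _ ⟨_, _, _, _, rfl⟩
    exact abs_nonneg _
  have h1 := ht p hp r hr x (fun c hc => (List.mem_append.mp hc).elim (hpx c) (hrx c)) (hgp ▸ h0)
  rw [← hgp, ← hgr] at h1
  exact h1.trans (mul_le_mul_of_nonneg_right ((le_abs_self _).trans (hle.trans hn)) h0)

/-! ### The quasiequational theory of MV-algebras -/

section Operations

variable {M : Type w} [BL.Structure M]

/-- The binary basic operations of a BL-structure. -/
def binOp (f : BLFunc 2) (a b : M) : M := Structure.funMap (L := BL) f ![a, b]

/-- The constant basic operations of a BL-structure. -/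
def nullOp (M : Type w) [BL.Structure M] (f : BLFunc 0) : M :=
  Structure.funMap (L := BL) f Fin.elim0

/-- The term formed from two terms by a binary operation symbol. -/
def binTerm {α : Type*} (f : BLFunc 2) (s t : BL.Term α) : BL.Term α :=
  Term.func (L := BL) (l := 2) f ![s, t]

/-- The term consisting of a constant symbol. -/
def nullTerm {α : Type*} (f : BLFunc 0) : BL.Term α := Term.func (L := BL) (l := 0) f Fin.elim0

variable {α : Type*}

@[simp]
theorem realize_binTerm (f : BLFunc 2) (s t : BL.Term α) (v : α → M) :
    (binTerm f s t).realize v = binOp f (s.realize v) (t.realize v) := by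
  simp only [binTerm, binOp, Term.realize]
  congr 1
  funext i
  fin_cases i <;> rfl

@[simp]
theorem realize_nullTerm (f : BLFunc 0) (v : α → M) :
    (nullTerm f : BL.Term α).realize v = nullOp M f := by
  simp only [nullTerm, nullOp, Term.realize]
  congr 1
  funext i
  exact i.elim0

theorem funMap_eq_binOp (f : BLFunc 2) (x : Fin 2 → M) :
    Structure.funMap (L := BL) f x = binOp f (x 0) (x 1) := by
  simp only [binOp]
  congr 1
  funext i
  fin_cases i <;> rfl

theorem funMap_eq_nullOp (f : BLFunc 0) (x : Fin 0 → M) :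
    Structure.funMap (L := BL) f x = nullOp M f := by
  simp only [nullOp]
  congr 1
  funext i
  exact i.elim0

end Operations

/-! ### Term functions on the unit interval -/

section Unit

variable {𝕜 : Type*} [Field 𝕜] [LinearOrder 𝕜] [IsStrictOrderedRing 𝕜]

attribute [local instance] lukStructure

theorem coe_nullOp_zero : ((nullOp (Set.Icc (0 : 𝕜) 1) BLFunc.zero : Set.Icc (0 : 𝕜) 1) : 𝕜) = 0 :=
  rfl

theorem coe_nullOp_one : ((nullOp (Set.Icc (0 : 𝕜) 1) BLFunc.one : Set.Icc (0 : 𝕜) 1) : 𝕜) = 1 :=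
  rfl

theorem coe_binOp_inf (a b : Set.Icc (0 : 𝕜) 1) :
    (binOp BLFunc.inf a b).1 = min (a : 𝕜) b := rfl

theorem coe_binOp_sup (a b : Set.Icc (0 : 𝕜) 1) :
    (binOp BLFunc.sup a b).1 = max (a : 𝕜) b := rfl

theorem coe_binOp_mul (a b : Set.Icc (0 : 𝕜) 1) :
    (binOp BLFunc.mul a b).1 = max 0 ((a : 𝕜) + b - 1) := rfl

theorem coe_binOp_imp (a b : Set.Icc (0 : 𝕜) 1) :
    (binOp BLFunc.imp a b).1 = min 1 (1 - (a : 𝕜) + b) := rfl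

theorem isPiecewiseAffine_realize (t : BL.Term ℕ) :
    IsPiecewiseAffine (fun x => ((t.realize x : Set.Icc (0 : ℚ) 1) : ℚ))
      (fun x => ((t.realize x : Set.Icc (0 : ℝ) 1) : ℝ)) := by
  induction t with
  | var i => exact .coord i
  | @func n f ts ih =>
    have h0 := IsPiecewiseAffine.const 0
    have h1 := IsPiecewiseAffine.const 1
    simp only [Rat.cast_zero, Rat.cast_one] at h0 h1
    cases f with
    | zero => exact h0
    | one => exact h1
    | inf => exact (ih 0).min (ih 1)
    | sup => exact (ih 0).max (ih 1)
    | mul => exact h0.max (((ih 0).add (ih 1)).sub h1)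
    | imp => exact h1.min ((h1.sub (ih 0)).add (ih 1))

/-- The Łukasiewicz algebra on the rational unit interval. -/
def rationalLuk : Bundled.{0} BL.Structure := ⟨Set.Icc (0 : ℚ) 1, lukStructure ℚ⟩

theorem exists_sub_le_mul_sum (q : BL.QuasiEquation) (hq : q.Valid rationalLuk) :
    ∃ n : ℕ, ∀ x : ℕ → Set.Icc (0 : ℝ) 1,
      |(q.conclusion.lhs.realize x).1 - (q.conclusion.rhs.realize x).1| ≤
        n * (q.premises.map fun e => |(e.lhs.realize x).1 - (e.rhs.realize x).1|).sum := by
  refine IsPiecewiseAffine.exists_le_nat_mul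
    (.list_sum q.premises fun e _ =>
      ((isPiecewiseAffine_realize e.lhs).sub (isPiecewiseAffine_realize e.rhs)).abs)
    ((isPiecewiseAffine_realize q.conclusion.lhs).sub
      (isPiecewiseAffine_realize q.conclusion.rhs)).abs (fun x => ?_) fun x hx => ?_
  · refine List.sum_nonneg ?_
    simp only [List.mem_map]
    rintro _ ⟨_, _, rfl⟩
    exact abs_nonneg _
  · have h := hq x fun e he => by
      have h1 : |(e.lhs.realize x).1 - (e.rhs.realize x).1| ≤ 0 := by
        refine (List.single_le_sum ?_ _ (List.mem_map.mpr ⟨e, he, rfl⟩)).trans hx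
        simp only [List.mem_map]
        rintro _ ⟨_, _, rfl⟩
        exact abs_nonneg _
      exact Subtype.ext (sub_eq_zero.mp (abs_nonpos_iff.mp h1))
    have h' : q.conclusion.lhs.realize x = q.conclusion.rhs.realize x := h
    rw [h', sub_self, abs_zero]

/-- The product of the biresidua `(s → t) · (t → s)` of the equations `s ≈ t` in a list. -/
def biresProd (l : List BL.Equation) : BL.Term ℕ :=
  l.foldr (fun e p => binTerm .mul (binTerm .mul (binTerm .imp e.lhs e.rhs)
    (binTerm .imp e.rhs e.lhs)) p) (nullTerm .one)

/-- The biresiduum of `a` and `b` is `1 - |a - b|`, and the Łukasiewicz product adds up distances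
from `1`, truncating at `0`. -/
theorem coe_realize_biresProd_le (l : List BL.Equation) (x : ℕ → Set.Icc (0 : 𝕜) 1) :
    ((biresProd l).realize x).1 ≤
      max 0 (1 - (l.map fun e => |(e.lhs.realize x).1 - (e.rhs.realize x).1|).sum) := by
  induction l with
  | nil => simp [biresProd, coe_nullOp_one]
  | cons e l ih =>
    change (((binTerm .mul (binTerm .mul (binTerm .imp e.lhs e.rhs)
      (binTerm .imp e.rhs e.lhs)) (biresProd l)).realize x : Set.Icc (0 : 𝕜) 1) : 𝕜) ≤ _
    simp only [realize_binTerm, coe_binOp_mul, coe_binOp_imp, List.map_cons, List.sum_cons]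
    refine max_le (le_max_left _ _) ?_
    set d := (l.map fun e => |(e.lhs.realize x).1 - (e.rhs.realize x).1|).sum
    set a : 𝕜 := (e.lhs.realize x).1
    set b : 𝕜 := (e.rhs.realize x).1
    have hab : max 0 (min 1 (1 - a + b) + min 1 (1 - b + a) - 1) ≤ 1 - |a - b| := by
      have ha := (e.lhs.realize x).2
      have hb := (e.rhs.realize x).2
      change 0 ≤ a ∧ a ≤ 1 at ha
      change 0 ≤ b ∧ b ≤ 1 at hb
      have h1 := min_le_left (1 : 𝕜) (1 - a + b)
      have h2 := min_le_right (1 : 𝕜) (1 - a + b)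
      have h3 := min_le_left (1 : 𝕜) (1 - b + a)
      have h4 := min_le_right (1 : 𝕜) (1 - b + a)
      rcases abs_cases (a - b) with ⟨h, _⟩ | ⟨h, _⟩ <;> rw [h] <;> refine max_le ?_ ?_ <;> linarith
    have habs := abs_nonneg (a - b)
    rcases le_max_iff.mp ih with h | h
    · exact le_max_of_le_left (by linarith)
    · exact le_max_of_le_right (by linarith)

end Unit

/-! ### Transfer from the real interval to all MV-algebras -/

theorem MV.realize_eq {A : Type w} [BL.Structure A] (hA : Bundled.of (c := BL.Structure) A ∈ MV) (s t : BL.Term ℕ)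
    (h : letI := lukStructure ℝ
      ∀ x : ℕ → Set.Icc (0 : ℝ) 1, (s.realize x).1 = (t.realize x).1) (v : ℕ → A) :
    s.realize v = t.realize v :=
  hA ⟨s, t⟩ (by rintro _ rfl x; exact Subtype.ext (h x)) v

theorem MV.mul_one {A : Type w} [BL.Structure A] (hA : Bundled.of (c := BL.Structure) A ∈ MV) (a : A) :
    binOp .mul a (nullOp A .one) = a := by
  simpa using MV.realize_eq hA (binTerm .mul (.var 0) (nullTerm .one)) (.var 0)
    (fun x => by
      simp [coe_binOp_mul, coe_nullOp_one, (x 0).2.1]) (fun _ => a)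

theorem MV.one_mul {A : Type w} [BL.Structure A] (hA : Bundled.of (c := BL.Structure) A ∈ MV) (a : A) :
    binOp .mul (nullOp A .one) a = a := by
  simpa using MV.realize_eq hA (binTerm .mul (nullTerm .one) (.var 0)) (.var 0)
    (fun x => by
      simp [coe_binOp_mul, coe_nullOp_one, (x 0).2.1]) (fun _ => a)

theorem MV.imp_self {A : Type w} [BL.Structure A] (hA : Bundled.of (c := BL.Structure) A ∈ MV) (a : A) :
    binOp .imp a a = nullOp A .one := by
  simpa using MV.realize_eq hA (binTerm .imp (.var 0) (.var 0)) (nullTerm .one)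
    (fun x => by simp [coe_binOp_imp, coe_nullOp_one]) (fun _ => a)

theorem MV.inf_comm {A : Type w} [BL.Structure A] (hA : Bundled.of (c := BL.Structure) A ∈ MV) (a b : A) :
    binOp .inf a b = binOp .inf b a := by
  simpa using MV.realize_eq hA (binTerm .inf (.var 0) (.var 1)) (binTerm .inf (.var 1) (.var 0))
    (fun x => by simp [coe_binOp_inf, min_comm]) (fun n => if n = 0 then a else b)

/-- With `MV.sup_eq`, this defines the lattice operations from `·` and `→`, which is why bookkeeping
axioms for `·` and `→` suffice. -/
theorem MV.inf_eq {A : Type w} [BL.Structure A] (hA : Bundled.of (c := BL.Structure) A ∈ MV) (a b : A) :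
    binOp .inf a b = binOp .mul a (binOp .imp a b) := by
  simpa using MV.realize_eq hA (binTerm .inf (.var 0) (.var 1))
    (binTerm .mul (.var 0) (binTerm .imp (.var 0) (.var 1)))
    (fun x => by
      have h0 := (x 0).2
      have h1 := (x 1).2
      simp only [realize_binTerm, Term.realize, coe_binOp_inf, coe_binOp_mul, coe_binOp_imp]
      rcases le_total (x 0 : ℝ) (x 1) with h | h
      · rw [min_eq_left h, min_eq_left (by linarith), max_eq_right (by linarith [h0.1])]; ring
      · rw [min_eq_right h, min_eq_right (by linarith), max_eq_right (by linarith [h1.1])]; ring)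
    (fun n => if n = 0 then a else b)

theorem MV.sup_eq {A : Type w} [BL.Structure A] (hA : Bundled.of (c := BL.Structure) A ∈ MV) (a b : A) :
    binOp .sup a b = binOp .imp (binOp .imp a b) b := by
  simpa using MV.realize_eq hA (binTerm .sup (.var 0) (.var 1))
    (binTerm .imp (binTerm .imp (.var 0) (.var 1)) (.var 1))
    (fun x => by
      have h0 := (x 0).2
      have h1 := (x 1).2
      simp only [realize_binTerm, Term.realize, coe_binOp_sup, coe_binOp_imp]
      rcases le_total (x 0 : ℝ) (x 1) with h | h
      · have h' : min 1 (1 - (x 0 : ℝ) + x 1) = 1 := min_eq_left (by linarith)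
        rw [max_eq_right h, h', min_eq_right (by linarith [h1.2])]; ring
      · have h' : min 1 (1 - (x 0 : ℝ) + x 1) = 1 - x 0 + x 1 := min_eq_right (by linarith)
        rw [max_eq_left h, h', min_eq_right (by linarith [h0.2])]; ring)
    (fun n => if n = 0 then a else b)

theorem MV.eq_of_zero_eq_one {A : Type w} [BL.Structure A] (hA : Bundled.of (c := BL.Structure) A ∈ MV)
    (h : nullOp A .zero = nullOp A .one) (a b : A) : a = b := by
  have key : ∀ a : A, a = nullOp A .zero := fun a => by
    have h0 := MV.realize_eq hA (binTerm .mul (.var 0) (nullTerm .zero)) (nullTerm .zero)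
      (fun x => by simp [coe_binOp_mul, coe_nullOp_zero, (x 0).2.2]) (fun _ => a)
    simp only [realize_binTerm, realize_nullTerm, Term.realize] at h0
    rw [← h0, h, MV.mul_one hA]
  rw [key a, key b]

theorem MV.realize_biresProd {A : Type w} [BL.Structure A] (hA : Bundled.of (c := BL.Structure) A ∈ MV) (l : List BL.Equation)
    (v : ℕ → A) (h : ∀ e ∈ l, e.Realize v) : (biresProd l).realize v = nullOp A .one := by
  induction l with
  | nil => simp [biresProd]
  | cons e l ih =>
    have he : e.lhs.realize v = e.rhs.realize v := h e List.mem_cons_self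
    have hl := ih fun d hd => h d (List.mem_cons_of_mem _ hd)
    simp only [biresProd, List.foldr_cons, realize_binTerm] at hl ⊢
    rw [hl, he, MV.imp_self hA, MV.mul_one hA, MV.mul_one hA]

/-- Let `p` be the `n`-th power of the product of the biresidua of the premises. The linear bound
gives `p ≤ 1 - |s - t|` on the real cube, so `p · s ≤ t` and `p · t ≤ s` are valid equations. When
the premises hold, `p = 1`, hence `s = t`. -/
theorem MV.quasiEquation_valid {A : Type w} [BL.Structure A] (hA : Bundled.of (c := BL.Structure) A ∈ MV) (q : BL.QuasiEquation)
    (hq : q.Valid rationalLuk) : q.Valid (Bundled.of (c := BL.Structure) A) := by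
  intro (v : ℕ → A) hv
  obtain ⟨n, hn⟩ := exists_sub_le_mul_sum q hq
  let _ := lukStructure ℝ
  let p := biresProd (List.replicate n q.premises).flatten
  have hp : p.realize v = nullOp A .one := MV.realize_biresProd hA _ v fun e he => by
    obtain ⟨l, hl, he⟩ := List.mem_flatten.mp he
    exact hv e (List.eq_of_mem_replicate hl ▸ he)
  have hle : ∀ x : ℕ → Set.Icc (0 : ℝ) 1, (p.realize x).1 ≤
      1 - |(q.conclusion.lhs.realize x).1 - (q.conclusion.rhs.realize x).1| := fun x => by
    refine (coe_realize_biresProd_le _ x).trans (max_le ?_ ?_)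
    · have h1 := (q.conclusion.lhs.realize x).2
      have h2 := (q.conclusion.rhs.realize x).2
      rw [sub_nonneg, abs_le]
      constructor <;> linarith [h1.1, h1.2, h2.1, h2.2]
    · have := hn x
      simp only [List.map_flatten, List.map_replicate, List.sum_flatten, List.sum_replicate,
        nsmul_eq_mul]
      linarith
  have key : ∀ s t : BL.Term ℕ, (∀ x : ℕ → Set.Icc (0 : ℝ) 1, (p.realize x).1 ≤
      1 - |(s.realize x).1 - (t.realize x).1|) →
      binOp .inf (s.realize v) (t.realize v) = s.realize v := fun s t hst => by
    have := MV.realize_eq hA (binTerm .inf (binTerm .mul p s) t) (binTerm .mul p s) (fun x => by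
      simp only [realize_binTerm, coe_binOp_inf, coe_binOp_mul]
      have h := hst x
      have h' := le_abs_self ((s.realize x).1 - (t.realize x).1)
      exact min_eq_left (max_le (t.realize x).2.1 (by linarith))) v
    simpa only [realize_binTerm, hp, MV.one_mul hA] using this
  have h1 := key q.conclusion.lhs q.conclusion.rhs hle
  have h2 := key q.conclusion.rhs q.conclusion.lhs fun x => by
    rw [abs_sub_comm]
    exact hle x
  exact h1.symm.trans ((MV.inf_comm hA _ _).trans h2)

/-! ### Rational constants in rational MV-algebras -/

/-- The inclusion of the rational into the real unit interval. -/
def ratToReal (a : Set.Icc (0 : ℚ) 1) : Set.Icc (0 : ℝ) 1 :=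
  ⟨(a : ℚ), by exact_mod_cast a.2.1, by exact_mod_cast a.2.2⟩

theorem realize_ratToReal (t : BL.Term ℕ) (v : ℕ → Set.Icc (0 : ℚ) 1) :
    letI := lukStructure ℝ
    letI := lukStructure ℚ
    t.realize (fun n => ratToReal (v n)) = ratToReal (t.realize v) := by
  induction t with
  | var i => rfl
  | @func n f ts ih =>
    simp only [Term.realize, ih]
    refine Subtype.ext ?_
    cases f with
    | zero => exact Rat.cast_zero.symm
    | one => exact Rat.cast_one.symm
    | inf => exact (Rat.cast_min _ _).symm
    | sup => exact (Rat.cast_max _ _).symm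
    | mul =>
      have h : ∀ a b : Set.Icc (0 : ℚ) 1, lukMul (ratToReal a) (ratToReal b) =
          ratToReal (lukMul a b) := fun a b => Subtype.ext (by simp [ratToReal, lukMul])
      exact congrArg Subtype.val (h _ _)
    | imp =>
      have h : ∀ a b : Set.Icc (0 : ℚ) 1, lukImp (ratToReal a) (ratToReal b) =
          ratToReal (lukImp a b) := fun a b => Subtype.ext (by simp [ratToReal, lukImp])
      exact congrArg Subtype.val (h _ _)

theorem rationalLuk_mem_MV : rationalLuk ∈ MV := by
  intro e he v
  let _ := lukStructure ℝ
  let _ := lukStructure ℚ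
  have h : ratToReal (e.lhs.realize v) = ratToReal (e.rhs.realize v) :=
    (realize_ratToReal e.lhs v).symm.trans ((he standardLuk rfl _).trans (realize_ratToReal e.rhs v))
  exact Subtype.ext (Rat.cast_injective (congrArg Subtype.val h))

/-- The reduct of a structure in the language with rational constants. -/
@[reducible]
def reductStructure (M : Type w) [RL.Structure M] : BL.Structure M :=
  (BL.lhomWithConstants RatUnit).reduct M

attribute [local instance] reductStructure

section RealizeRL

/-- The interpretation of the constant `c_q`. -/
def constVal (M : Type w) [RL.Structure M] (q : RatUnit) : M :=
  Structure.funMap (L := RL) (n := 0) (Sum.inr q) Fin.elim0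

variable {M : Type w} [RL.Structure M] {α : Type*}

theorem realize_cTerm (q : RatUnit) (v : ℕ → M) : (cTerm q).realize v = constVal M q := by
  simp only [cTerm, Constants.term, Term.realize, constVal]
  congr 1
  funext i
  exact i.elim0

theorem realize_func_inl {n : ℕ} (f : BLFunc n) (ts : Fin n → RL.Term α) (v : α → M) :
    (Term.func (L := RL) (l := n) (Sum.inl f) ts).realize v =
      Structure.funMap (L := BL) f fun i => (ts i).realize v := rfl

theorem realize_func_inr (q : RatUnit) (ts : Fin 0 → RL.Term α) (v : α → M) :
    (Term.func (L := RL) (l := 0) (Sum.inr q) ts).realize v = constVal M q := by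
  simp only [Term.realize, constVal]
  congr 1
  funext i
  exact i.elim0

theorem realize_oneTerm (v : ℕ → M) : oneTerm.realize v = nullOp M .one :=
  (realize_func_inl _ _ _).trans (funMap_eq_nullOp _ _)

theorem realize_zeroTerm (v : ℕ → M) : zeroTerm.realize v = nullOp M .zero :=
  (realize_func_inl _ _ _).trans (funMap_eq_nullOp _ _)

theorem realize_mulTerm (s t : RL.Term ℕ) (v : ℕ → M) :
    (mulTerm s t).realize v = binOp .mul (s.realize v) (t.realize v) :=
  (realize_func_inl _ _ _).trans (funMap_eq_binOp _ _)

theorem realize_impTerm (s t : RL.Term ℕ) (v : ℕ → M) :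
    (impTerm s t).realize v = binOp .imp (s.realize v) (t.realize v) :=
  (realize_func_inl _ _ _).trans (funMap_eq_binOp _ _)

end RealizeRL

section RMV

variable {A : Bundled.{w} RL.Structure}

theorem RMV.reduct_mem (hA : A ∈ RMV) : Bundled.of (c := BL.Structure) A ∈ MV := hA.1

theorem RMV.mul_constVal (hA : A ∈ RMV) (p q : RatUnit) :
    binOp .mul (constVal A p) (constVal A q) = constVal A (lukMul p q) := by
  have h := hA.2 _ (.mul p q) fun _ => constVal A p
  simpa only [Equation.Realize, realize_mulTerm, realize_cTerm] using h

theorem RMV.imp_constVal (hA : A ∈ RMV) (p q : RatUnit) :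
    binOp .imp (constVal A p) (constVal A q) = constVal A (lukImp p q) := by
  have h := hA.2 _ (.imp p q) fun _ => constVal A p
  simpa only [Equation.Realize, realize_impTerm, realize_cTerm] using h

theorem RMV.constVal_zero (hA : A ∈ RMV) : constVal A 0 = nullOp A .zero := by
  have h := hA.2 _ .zero fun _ => constVal A 0
  simp only [Equation.Realize] at h
  rwa [realize_cTerm, realize_zeroTerm] at h

theorem RMV.constVal_one (hA : A ∈ RMV) : constVal A 1 = nullOp A .one := by
  have h := hA.2 _ .one fun _ => constVal A 0
  simp only [Equation.Realize] at h
  rwa [realize_cTerm, realize_oneTerm] at h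

theorem RMV.inf_constVal (hA : A ∈ RMV) (p q : RatUnit) :
    binOp .inf (constVal A p) (constVal A q) = constVal A (p ⊓ q) := by
  have h : p ⊓ q = lukMul p (lukImp p q) :=
    let _ := lukStructure ℚ
    MV.inf_eq rationalLuk_mem_MV p q
  rw [MV.inf_eq (RMV.reduct_mem hA), RMV.imp_constVal hA, RMV.mul_constVal hA, h]

theorem RMV.sup_constVal (hA : A ∈ RMV) (p q : RatUnit) :
    binOp .sup (constVal A p) (constVal A q) = constVal A (p ⊔ q) := by
  have h : p ⊔ q = lukImp (lukImp p q) q :=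
    let _ := lukStructure ℚ
    MV.sup_eq rationalLuk_mem_MV p q
  rw [MV.sup_eq (RMV.reduct_mem hA), RMV.imp_constVal hA, RMV.imp_constVal hA, h]

/-- The constants form a homomorphic image of the rational algebra. -/
theorem RMV.realize_constVal (hA : A ∈ RMV) (t : RL.Term ℕ) (v : ℕ → RatUnit) :
    letI := ratLukStructure ℚ
    t.realize (fun n => constVal A (v n)) = constVal A (t.realize v) := by
  let _ := ratLukStructure ℚ
  induction t with
  | var i => rfl
  | @func n f ts ih =>
    rcases f with f | q
    · refine (realize_func_inl f ts _).trans (Eq.trans ?_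
        (congrArg (constVal A) (realize_func_inl f ts v).symm))
      simp only [ih]
      cases f with
      | zero => exact (funMap_eq_nullOp _ _).trans (RMV.constVal_zero hA).symm
      | one => exact (funMap_eq_nullOp _ _).trans (RMV.constVal_one hA).symm
      | inf => exact (funMap_eq_binOp _ _).trans (RMV.inf_constVal hA _ _)
      | sup => exact (funMap_eq_binOp _ _).trans (RMV.sup_constVal hA _ _)
      | mul => exact (funMap_eq_binOp _ _).trans (RMV.mul_constVal hA _ _)
      | imp => exact (funMap_eq_binOp _ _).trans (RMV.imp_constVal hA _ _)
    · cases n with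
      | zero =>
        exact (realize_func_inr q ts _).trans (congrArg (constVal A)
          ((realize_func_inr q ts v).trans (Subtype.ext (Rat.cast_id _))).symm)
      | succ n => exact PEmpty.elim q

/-- All powers of `c_r` are then `1`, while the `n`-th power of `r` is `max 0 (1 - n (1 - r))`,
which is `0` for large `n`. -/
theorem RMV.constVal_eq_one (hA : A ∈ RMV) {r : RatUnit} (h : constVal A r = constVal A 1)
    (hr : r ≠ 1) (a b : A) : a = b := by
  have hr1 : (r : ℚ) < 1 := lt_of_le_of_ne r.2.2 fun h => hr (Subtype.ext h)
  have key : ∀ n : ℕ, ∃ s : RatUnit, constVal A s = constVal A 1 ∧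
      (s : ℚ) = max 0 (1 - (n : ℚ) * (1 - (r : ℚ))) := by
    intro n
    induction n with
    | zero => exact ⟨1, rfl, by simp⟩
    | succ n ih =>
      obtain ⟨s, hs, hs'⟩ := ih
      refine ⟨lukMul s r, ?_, ?_⟩
      · rw [← RMV.mul_constVal hA, hs, h, RMV.constVal_one hA, MV.mul_one (RMV.reduct_mem hA)]
      · change max 0 ((s : ℚ) + r - 1) = _
        rw [hs']
        push_cast
        rcases le_total 0 (1 - n * (1 - (r : ℚ))) with h0 | h0
        · rw [max_eq_right h0]; congr 1; ring
        · rw [max_eq_left h0, max_eq_left (by linarith), max_eq_left (by linarith)]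
  obtain ⟨n, hn⟩ := exists_nat_ge (1 / (1 - (r : ℚ)))
  obtain ⟨s, hs, hs'⟩ := key n
  rw [div_le_iff₀ (by linarith)] at hn
  have hs0 : s = 0 := Subtype.ext (by rw [hs', max_eq_left (by linarith)]; rfl)
  rw [hs0, RMV.constVal_zero hA, RMV.constVal_one hA] at hs
  exact MV.eq_of_zero_eq_one (RMV.reduct_mem hA) hs a b

theorem RMV.constVal_injective (hA : A ∈ RMV) [Nontrivial A] :
    Function.Injective (constVal A) := by
  have key : ∀ p q : RatUnit, constVal A p = constVal A q → (q : ℚ) ≤ p := by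
    intro p q h
    by_contra hlt
    obtain ⟨a, b, hab⟩ := exists_pair_ne A
    -- If `p < q`, then `q → p = 1 - q + p < 1`, although `c_q → c_p = 1` because the two constants
    -- coincide.
    refine hab (RMV.constVal_eq_one hA (r := lukImp q p) ?_ ?_ a b)
    · rw [← RMV.imp_constVal hA, h, MV.imp_self (RMV.reduct_mem hA), RMV.constVal_one hA]
    · intro h1
      have h2 : min 1 (1 - (q : ℚ) + p) = 1 := congrArg Subtype.val h1
      linarith [min_eq_left_iff.mp h2]
  exact fun p q h => Subtype.ext (le_antisymm (key q p h.symm) (key p q h))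

end RMV

theorem rationalLukQ_mem_RMV : rationalLukQ ∈ RMV := by
  refine ⟨rationalLuk_mem_MV, ?_⟩
  have hc : ∀ (q : RatUnit) (v : ℕ → rationalLukQ), (cTerm q).realize v = q := fun q v =>
    (realize_cTerm q v).trans (Subtype.ext (Rat.cast_id _))
  rintro e (⟨p, q⟩ | ⟨p, q⟩ | _ | _) v
  · exact (realize_mulTerm _ _ v).trans ((congrArg₂ lukMul (hc p v) (hc q v)).trans (hc _ v).symm)
  · exact (realize_impTerm _ _ v).trans ((congrArg₂ lukImp (hc p v) (hc q v)).trans (hc _ v).symm)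
  · exact (hc _ v).trans (realize_zeroTerm v).symm
  · exact (hc _ v).trans (realize_oneTerm v).symm

/-! ### Elimination of the constants from quasiequations -/

/-- The term `t ⊕ ⋯ ⊕ t` with `k` summands. -/
def nsumTerm {α : Type*} (t : BL.Term α) : ℕ → BL.Term α
  | 0 => nullTerm .zero
  | k + 1 => binTerm .imp (binTerm .imp t (nullTerm .zero)) (nsumTerm t k)

/-- The translation of a term with constants into a term without constants, in which the constant
`c_{k/N}` is replaced by the `k`-fold sum of the variable `x₀`, and other variables are shifted. -/
def elimConst (N : ℕ) : RL.Term ℕ → BL.Term ℕ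
  | .var i => .var (i + 1)
  | .func (Sum.inl f) ts => .func f fun i => elimConst N (ts i)
  | .func (l := 0) (Sum.inr q) _ => nsumTerm (.var 0) ⌊(q : RatUnit).1 * N⌋₊
  | .func (l := _ + 1) (Sum.inr q) _ => PEmpty.elim q

/-- A common denominator of the constants in a term. -/
def termDen : RL.Term ℕ → ℕ
  | .var _ => 1
  | .func (Sum.inl _) ts => ∏ i, termDen (ts i)
  | .func (l := 0) (Sum.inr q) _ => (q : RatUnit).1.den
  | .func (l := _ + 1) (Sum.inr q) _ => PEmpty.elim q

theorem termDen_pos (t : RL.Term ℕ) : 0 < termDen t := by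
  induction t with
  | var i => exact Nat.one_pos
  | @func n f ts ih =>
    rcases f with f | q
    · exact Finset.prod_pos fun i _ => ih i
    · cases n with
      | zero => exact Rat.den_pos _
      | succ n => exact PEmpty.elim q

theorem RMV.realize_nsumTerm {A : Bundled.{w} RL.Structure} (hA : A ∈ RMV) {N : ℕ} {u : RatUnit}
    (hu : (u : ℚ) * N = 1) {α : Type*} (t : BL.Term α) (v : α → A) (ht : t.realize v = constVal A u)
    (k : ℕ) (q : RatUnit) (hq : (q : ℚ) * N = k) : (nsumTerm t k).realize v = constVal A q := by
  have hN : (N : ℚ) ≠ 0 := right_ne_zero_of_mul_eq_one hu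
  induction k generalizing q with
  | zero =>
    have hq0 : q = 0 := by
      rcases mul_eq_zero.mp (hq.trans Nat.cast_zero) with h | h
      exacts [Subtype.ext h, absurd h hN]
    rw [nsumTerm, realize_nullTerm, hq0, RMV.constVal_zero hA]
  | succ k ih =>
    have hle : (u : ℚ) ≤ q := by
      have hN' : (0 : ℚ) < N := lt_of_le_of_ne N.cast_nonneg hN.symm
      refine le_of_mul_le_mul_right ?_ hN'
      rw [hu, hq]
      exact_mod_cast Nat.succ_le_succ k.zero_le
    have hu0 : (0 : ℚ) ≤ u := u.2.1
    have hu1 : (u : ℚ) ≤ 1 := u.2.2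
    have hq1 : (q : ℚ) ≤ 1 := q.2.2
    -- One summand is split off: `q = u ⊕ q'`, with no truncation since `q ≤ 1`.
    let q' : RatUnit := ⟨q - u, sub_nonneg.mpr hle, by linarith⟩
    have hq' := ih q' (by
      change ((q : ℚ) - u) * N = k
      rw [sub_mul, hq, hu]
      push_cast
      ring)
    have hlast : lukImp (lukImp u 0) q' = q := by
      refine Subtype.ext ?_
      change min 1 (1 - min 1 (1 - (u : ℚ) + 0) + ((q : ℚ) - u)) = q
      have h1 : min 1 (1 - (u : ℚ) + 0) = 1 - u := by
        rw [min_eq_right (by linarith)]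
        ring
      rw [h1, min_eq_right (by linarith)]
      ring
    rw [nsumTerm, realize_binTerm, realize_binTerm, realize_nullTerm, ht, hq',
      ← RMV.constVal_zero hA, RMV.imp_constVal hA, RMV.imp_constVal hA, hlast]

/-- The assignment to the variables of a translated term. -/
def consAssignment {M : Type*} (a : M) (v : ℕ → M) : ℕ → M
  | 0 => a
  | n + 1 => v n

theorem RMV.realize_elimConst {A : Bundled.{w} RL.Structure} (hA : A ∈ RMV) {N : ℕ} {u : RatUnit}
    (hu : (u : ℚ) * N = 1) (t : RL.Term ℕ) (ht : termDen t ∣ N) (v : ℕ → A) :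
    (elimConst N t).realize (consAssignment (constVal A u) v) = t.realize v := by
  induction t with
  | var i => rfl
  | @func n f ts ih =>
    rcases f with f | q
    · refine Eq.trans ?_ (realize_func_inl f ts v).symm
      have h : ∀ i, termDen (ts i) ∣ N := fun i =>
        (Finset.dvd_prod_of_mem (fun i => termDen (ts i)) (Finset.mem_univ i)).trans ht
      exact congrArg (Structure.funMap (L := BL) f) (funext fun i => ih i (h i))
    · cases n with
      | zero =>
        refine Eq.trans ?_ (realize_func_inr q ts v).symm
        change RatUnit at q
        refine RMV.realize_nsumTerm hA hu (.var 0) _ rfl _ q ?_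
        have hd : (q : ℚ).den ∣ N := ht
        obtain ⟨m, rfl⟩ := hd
        -- The denominator of `q` divides `N`, so the floor in `elimConst` is exact.
        have hk : (q : ℚ) * ((q : ℚ).den * m : ℕ) = ((q : ℚ).num.toNat * m : ℕ) := by
          have h0 : (((q : ℚ).num.toNat : ℤ) : ℚ) = (q : ℚ).num := by
            rw [Int.toNat_of_nonneg (Rat.num_nonneg.mpr q.2.1)]
          push_cast at h0 ⊢
          rw [← mul_assoc, Rat.mul_den_eq_num, h0]
        rw [hk, Nat.floor_natCast]
      | succ n => exact PEmpty.elim q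

theorem coe_realize_nsumTerm {α : Type*} (t : BL.Term α) (k : ℕ) (v : α → Set.Icc (0 : ℚ) 1) :
    letI := lukStructure ℚ
    ((nsumTerm t k).realize v).1 = min 1 (k * (t.realize v).1) := by
  let _ := lukStructure ℚ
  have ht0 : 0 ≤ (t.realize v).1 := (t.realize v).2.1
  have ht1 : (t.realize v).1 ≤ 1 := (t.realize v).2.2
  induction k with
  | zero => simp [nsumTerm, coe_nullOp_zero]
  | succ k ih =>
    simp only [nsumTerm, realize_binTerm, realize_nullTerm, coe_binOp_imp, coe_nullOp_zero, ih]
    have h1 : min 1 (1 - (t.realize v).1 + 0) = 1 - (t.realize v).1 := by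
      rw [min_eq_right (by linarith)]
      ring
    rw [h1]
    push_cast
    rcases le_total 1 ((k : ℚ) * (t.realize v).1) with h | h
    · rw [min_eq_left h, min_eq_left (by linarith), min_eq_left (by linarith)]
    · rw [min_eq_right h]
      congr 1
      ring

/-- The equation `(N - 1) x₀ ≈ ¬ x₀`, which defines `1 / N` in the Łukasiewicz algebra. -/
def unitFractionEquation (N : ℕ) : BL.Equation :=
  ⟨nsumTerm (.var 0) (N - 1), binTerm .imp (.var 0) (nullTerm .zero)⟩

theorem mul_eq_one_of_unitFractionEquation {N : ℕ} (hN : 0 < N) (v : ℕ → Set.Icc (0 : ℚ) 1)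
    (h : letI := lukStructure ℚ; (unitFractionEquation N).Realize v) : (v 0 : ℚ) * N = 1 := by
  let _ := lukStructure ℚ
  have h' := congrArg Subtype.val h
  simp only [unitFractionEquation, coe_realize_nsumTerm, Term.realize, realize_binTerm,
    realize_nullTerm, coe_binOp_imp, coe_nullOp_zero] at h'
  have h0 : (0 : ℚ) ≤ v 0 := (v 0).2.1
  rw [min_eq_right (by linarith : 1 - (v 0 : ℚ) + 0 ≤ 1), Nat.cast_pred hN] at h'
  -- Were the sum truncated at `1`, the equation would force `v 0 = 0`, and then nothing is
  -- truncated.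
  rcases le_total 1 (((N : ℚ) - 1) * v 0) with h1 | h1
  · rw [min_eq_left h1] at h'
    have : (v 0 : ℚ) = 0 := by linarith
    rw [this] at h1
    linarith
  · rw [min_eq_right h1] at h'
    linarith

theorem RMV.realize_unitFractionEquation {A : Bundled.{w} RL.Structure} (hA : A ∈ RMV) {N : ℕ}
    (hN : 0 < N) {u : RatUnit} (hu : (u : ℚ) * N = 1) (v : ℕ → A) :
    (unitFractionEquation N).Realize (consAssignment (constVal A u) v) := by
  have hu0 : (0 : ℚ) ≤ u := u.2.1
  have h := RMV.realize_nsumTerm hA hu (.var 0) (consAssignment (constVal A u) v) rfl (N - 1)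
    (lukImp u 0) (by
      change min 1 (1 - (u : ℚ) + 0) * N = _
      rw [min_eq_right (by linarith), Nat.cast_pred hN, add_zero, sub_mul, hu, one_mul])
  refine h.trans ?_
  simp only [unitFractionEquation, realize_binTerm, realize_nullTerm, Term.realize, consAssignment]
  rw [← RMV.constVal_zero hA, RMV.imp_constVal hA]

/-- A common denominator of the constants in an equation. -/
def equationDen (e : RL.Equation) : ℕ := termDen e.lhs * termDen e.rhs

theorem RMV.realize_elimConst_equation {A : Bundled.{w} RL.Structure} (hA : A ∈ RMV) {N : ℕ}
    {u : RatUnit} (hu : (u : ℚ) * N = 1) (e : RL.Equation) (he : equationDen e ∣ N) (v : ℕ → A) :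
    (⟨elimConst N e.lhs, elimConst N e.rhs⟩ : BL.Equation).Realize
      (consAssignment (constVal A u) v) ↔ e.Realize v := by
  simp only [Equation.Realize]
  rw [RMV.realize_elimConst hA hu _ ((Dvd.intro _ rfl).trans he),
    RMV.realize_elimConst hA hu _ ((Dvd.intro_left _ rfl).trans he)]

/-- A quasiequation that is valid in the rational algebra is valid in all rational MV-algebras. -/
theorem RMV.quasiEquation_valid {A : Bundled.{w} RL.Structure} (hA : A ∈ RMV)
    (q : RL.QuasiEquation) (hq : q.Valid rationalLukQ) : q.Valid A := by
  let N := equationDen q.conclusion * (q.premises.map equationDen).prod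
  have hpos : ∀ e, 0 < equationDen e := fun e => Nat.mul_pos (termDen_pos _) (termDen_pos _)
  have hN : 0 < N := by
    refine Nat.mul_pos (hpos _) (List.prod_pos ?_)
    simp only [List.mem_map]
    rintro _ ⟨e, _, rfl⟩
    exact hpos e
  have hN' : (N : ℚ) ≠ 0 := by exact_mod_cast hN.ne'
  have hcon : equationDen q.conclusion ∣ N := Dvd.intro _ rfl
  have hpre : ∀ e ∈ q.premises, equationDen e ∣ N := fun e he =>
    (List.dvd_prod (List.mem_map.mpr ⟨e, he, rfl⟩)).trans (Dvd.intro_left _ rfl)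
  let tr : RL.Equation → BL.Equation := fun e => ⟨elimConst N e.lhs, elimConst N e.rhs⟩
  -- The extra premise pins `x₀` to `1 / N` in the rational algebra, so there `q'` says the same as
  -- `q`. In `A` it holds for `x₀ = c_{1/N}`, which recovers `q`.
  let q' : BL.QuasiEquation := ⟨unitFractionEquation N :: q.premises.map tr, tr q.conclusion⟩
  have hq' : q'.Valid rationalLuk := by
    intro v hv
    have hv0 := mul_eq_one_of_unitFractionEquation hN v (hv _ List.mem_cons_self)
    have hcons : v = consAssignment (constVal rationalLukQ (v 0)) (fun n => v (n + 1)) := by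
      funext n
      cases n with
      | zero => exact (Subtype.ext (Rat.cast_id _)).symm
      | succ n => rfl
    rw [hcons] at hv ⊢
    refine (RMV.realize_elimConst_equation rationalLukQ_mem_RMV hv0 _ hcon _).mpr
      (hq _ fun e he => ?_)
    exact (RMV.realize_elimConst_equation rationalLukQ_mem_RMV hv0 _ (hpre e he) _).mp
      (hv _ (List.mem_cons_of_mem _ (List.mem_map.mpr ⟨e, he, rfl⟩)))
  intro v hv
  let u : RatUnit := ⟨(N : ℚ)⁻¹, inv_nonneg.mpr N.cast_nonneg,
    inv_le_one_of_one_le₀ (by exact_mod_cast hN)⟩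
  have hu : (u : ℚ) * N = 1 := inv_mul_cancel₀ hN'
  refine (RMV.realize_elimConst_equation hA hu _ hcon v).mp
    (MV.quasiEquation_valid (RMV.reduct_mem hA) q' hq' _ fun e he => ?_)
  rcases List.mem_cons.mp he with rfl | he
  · exact RMV.realize_unitFractionEquation hA hN hu v
  · obtain ⟨e, he', rfl⟩ := List.mem_map.mp he
    exact (RMV.realize_elimConst_equation hA hu _ (hpre e he') v).mpr (hv e he')

/-- A quasiequation that is valid in a nontrivial rational MV-algebra is valid in the rational
algebra. -/
theorem RMV.quasiEquation_valid_rationalLukQ {A : Bundled.{w} RL.Structure} (hA : A ∈ RMV)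
    [Nontrivial A] (q : RL.QuasiEquation) (hq : q.Valid A) : q.Valid rationalLukQ := by
  intro v hv
  have key : ∀ e : RL.Equation, e.Realize (fun n => constVal A (v n)) ↔ e.Realize v := by
    intro e
    have h1 := RMV.realize_constVal hA e.lhs v
    have h2 := RMV.realize_constVal hA e.rhs v
    simp only [Equation.Realize]
    rw [h1, h2]
    exact (RMV.constVal_injective hA).eq_iff
  exact (key _).mp (hq _ fun e he => (key e).mpr (hv e he))

theorem realize_onTerm_lhomWithConstants {M : Type w} [RL.Structure M] (t : BL.Term ℕ)
    (v : ℕ → M) : ((BL.lhomWithConstants RatUnit).onTerm t).realize v = t.realize v := by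
  induction t with
  | var i => rfl
  | func f ts ih => exact congrArg (Structure.funMap (L := BL) f) (funext ih)

theorem RMV_eq_genQuasivariety : RMV.{w} = genQuasivariety {rationalLukQ} := by
  ext A
  refine ⟨fun hA q hq => RMV.quasiEquation_valid hA q (hq _ rfl), fun hA => ⟨fun e he (v : ℕ → A) => ?_, ?_⟩⟩
  · have h := hA ⟨[], ⟨(BL.lhomWithConstants RatUnit).onTerm e.lhs,
      (BL.lhomWithConstants RatUnit).onTerm e.rhs⟩⟩ (by
        rintro _ rfl v -
        exact (realize_onTerm_lhomWithConstants e.lhs v).trans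
          ((rationalLuk_mem_MV e he v).trans (realize_onTerm_lhomWithConstants e.rhs v).symm))
      v (by simp)
    exact (realize_onTerm_lhomWithConstants e.lhs v).symm.trans
      (h.trans (realize_onTerm_lhomWithConstants e.rhs v))
  · intro e he v
    exact hA ⟨[], e⟩ (by rintro _ rfl v -; exact rationalLukQ_mem_RMV.2 e he v) v (by simp)

/-! ### Minimality -/

/-- The copy of the rational algebra in an arbitrary universe. -/
def rationalLukULift : Bundled.{w} RL.Structure :=
  ⟨ULift.{w} rationalLukQ, Equiv.inducedStructure Equiv.ulift.symm⟩

theorem rationalLukULift_mem_RMV : rationalLukULift.{w} ∈ RMV := by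
  rw [RMV_eq_genQuasivariety]
  intro q hq v hv
  let φ : rationalLukQ ≃[RL] rationalLukULift.{w} :=
    Equiv.inducedStructureEquiv (L := RL) (Equiv.ulift.{w, 0} (α := rationalLukQ)).symm
  have key : ∀ e : RL.Equation, e.Realize (fun n => φ.symm (v n)) ↔ e.Realize v := by
    intro e
    have h : ∀ t : RL.Term ℕ, t.realize (fun n => φ.symm (v n)) = φ.symm (t.realize v) := fun t =>
      HomClass.realize_term φ.symm (t := t) (v := v)
    simp only [Equation.Realize, h]
    exact φ.symm.injective.eq_iff
  exact (key _).mp (hq _ rfl _ fun e he => (key e).mpr (hv e he))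

theorem isMinimalQuasivariety_RMV : IsMinimalQuasivariety RMV.{w} := by
  refine ⟨⟨{q | q.Valid rationalLukQ}, ?_⟩, ⟨rationalLukULift, rationalLukULift_mem_RMV, ?_⟩, ?_⟩
  · rw [RMV_eq_genQuasivariety]
    ext A
    simp [genQuasivariety]
  · exact ⟨⟨⟨0, le_rfl, zero_le_one⟩⟩, ⟨⟨1, zero_le_one, le_rfl⟩⟩, fun h =>
      zero_ne_one (congrArg (fun x : ULift RatUnit => (x.down : ℚ)) h)⟩
  · rintro M ⟨Φ, rfl⟩ hM ⟨B, hB, hBn⟩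
    -- The nontrivial member `B` contains a copy of the rational algebra, so every axiom of the
    -- subclass is valid there and hence in all of `RMV`.
    refine hM.antisymm fun A hA q hq => RMV.quasiEquation_valid hA q ?_
    exact RMV.quasiEquation_valid_rationalLukQ (hM hB) q (hB q hq)

/-! ### Rational Łukasiewicz logic -/

attribute [local instance] ratLukStructure in
theorem RLuk_entails_of_rationalLukQ {Γ : Set (RL.Term ℕ)} (hΓ : Γ.Finite) {φ : RL.Term ℕ}
    (h : ∀ v : ℕ → RatUnit, (∀ γ ∈ Γ, γ.realize v = 1) → φ.realize v = 1) : RLuk.Entails Γ φ := by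
  have hone : ∀ v : ℕ → RatUnit, oneTerm.realize v = 1 := fun v => realize_oneTerm v
  refine ⟨Γ, subset_rfl, hΓ, fun A hA v hv => ?_⟩
  refine RMV.quasiEquation_valid hA ⟨hΓ.toFinset.toList.map tau, tau φ⟩ ?_ v fun e he => ?_
  · intro v hv
    refine (h v fun γ hγ => ?_).trans (hone v).symm
    exact (hv _ (List.mem_map.mpr ⟨γ, by simpa using hγ, rfl⟩)).trans (hone v)
  · obtain ⟨γ, hγ, rfl⟩ := List.mem_map.mp he
    exact hv _ ⟨γ, by simpa using hγ, rfl⟩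

-- Every element of the rational algebra is named by a constant, so evaluating `φ` at `v` amounts to
-- substituting constants, and the resulting formula has the same value under every assignment.
attribute [local instance] ratLukStructure in
theorem RLuk_theorem_subst_constants (v : ℕ → RatUnit) (φ : RL.Term ℕ) :
    RLuk.Entails ∅ (φ.subst fun n => cTerm (v n)) ↔ φ.realize v = 1 := by
  have hone : ∀ v : ℕ → RatUnit, oneTerm.realize v = 1 := fun v => realize_oneTerm v
  have hval : ∀ u : ℕ → RatUnit, (φ.subst fun n => cTerm (v n)).realize u = φ.realize v := by
    intro u
    rw [Term.realize_subst]
    congr 1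
  constructor
  · rintro ⟨Δ, hΔ, -, h⟩
    have h1 : (φ.subst fun n => cTerm (v n)).realize v = oneTerm.realize v :=
      h rationalLukQ rationalLukQ_mem_RMV v (by
        rw [Set.subset_empty_iff.mp hΔ]
        simp)
    rwa [hval, hone] at h1
  · intro h
    exact RLuk_entails_of_rationalLukQ Set.finite_empty fun u _ => (hval u).trans h

theorem RLuk_consistent : RLuk.Consistent := by
  refine ⟨cTerm 0, fun h => ?_⟩
  let _ := ratLukStructure ℚ
  have h1 := (RLuk_theorem_subst_constants (fun _ => 0) (.var 0)).mp h
  exact zero_ne_one (congrArg Subtype.val h1)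

attribute [local instance] ratLukStructure in
/-- A consistent extension of rational Łukasiewicz logic derives only rules that are sound in the
rational algebra. -/
theorem realize_eq_one_of_isExtension {l : PropLogic RL} (hl : l.IsExtension RLuk)
    (hc : l.Consistent) {Γ : Set (RL.Term ℕ)} {φ : RL.Term ℕ} (h : l.Entails Γ φ)
    (v : ℕ → RatUnit) (hv : ∀ γ ∈ Γ, γ.realize v = 1) : φ.realize v = 1 := by
  by_contra hφ
  obtain ⟨ψ, hψ⟩ := hc
  have h1 : l.Entails ∅ (φ.subst fun n => cTerm (v n)) := by
    refine l.cut _ _ _ ?_ (l.subst_invariant (fun n => cTerm (v n)) Γ φ h)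
    rintro _ ⟨γ, hγ, rfl⟩
    exact hl _ _ ((RLuk_theorem_subst_constants v γ).mpr (hv γ hγ))
  -- The substituted formula has a constant value other than `1`, so as a premise it is never
  -- satisfied in the rational algebra and `RLuk` derives every `ψ` from it.
  refine hψ (l.cut _ {φ.subst fun n => cTerm (v n)} _ (by simpa using h1) (hl _ _ ?_))
  refine RLuk_entails_of_rationalLukQ (Set.finite_singleton _) fun u hu => absurd ?_ hφ
  have h2 := hu _ rfl
  rw [Term.realize_subst] at h2
  rw [← h2]
  congr 1

theorem eq_RLuk_of_isExtension {l : PropLogic RL} (hl : l.IsExtension RLuk) (hc : l.Consistent) :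
    l = RLuk := by
  ext Γ φ
  refine ⟨fun h => ?_, hl Γ φ⟩
  obtain ⟨Δ, hΔ, hfin, h⟩ := l.finitary Γ φ h
  exact RLuk.cut _ Δ _ (fun δ hδ => RLuk.refl _ _ (hΔ hδ))
    (RLuk_entails_of_rationalLukQ hfin (realize_eq_one_of_isExtension hl hc h))

/-- An assignment refuting the rule in the rational algebra would be a substitution of constants
refuting its admissibility. -/
theorem RLuk_structurallyComplete : RLuk.StructurallyComplete := fun _ _ hΓ h =>
  RLuk_entails_of_rationalLukQ hΓ fun v hv => (RLuk_theorem_subst_constants v _).mp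
    (h _ fun γ hγ => (RLuk_theorem_subst_constants v γ).mpr (hv γ hγ))

theorem RLuk_hereditarilyStructurallyComplete : RLuk.HereditarilyStructurallyComplete := by
  intro l hl
  by_cases hc : l.Consistent
  · rw [eq_RLuk_of_isExtension hl hc]
    exact RLuk_structurallyComplete
  -- In an inconsistent extension every formula is a theorem, so every rule is derivable.
  · intro Γ φ _ _
    simp only [PropLogic.Consistent, not_exists, not_not] at hc
    exact l.cut Γ ∅ φ (by simp) (hc φ)

end RatLuk

/-- Rational Łukasiewicz logic is consistent, has no proper consistent extension, and is
hereditarily structurally complete; the class of rational MV-algebras is a minimal quasivariety,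
generated as a quasivariety by the rational algebra on `[0, 1] ∩ ℚ`. -/
theorem theorem9p1 :
    (RatLuk.RLuk.Consistent ∧
      ∀ l : PropLogic RatLuk.RL, l.IsExtension RatLuk.RLuk → l.Consistent → l = RatLuk.RLuk) ∧
    RatLuk.RLuk.HereditarilyStructurallyComplete ∧
    IsMinimalQuasivariety RatLuk.RMV.{w} ∧
    RatLuk.RMV.{w} = genQuasivariety {RatLuk.rationalLukQ} := by
  exact ⟨⟨RatLuk.RLuk_consistent, fun _ hl hc => RatLuk.eq_RLuk_of_isExtension hl hc⟩,
    RatLuk.RLuk_hereditarilyStructurallyComplete, RatLuk.isMinimalQuasivariety_RMV,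
    RatLuk.RMV_eq_genQuasivariety⟩
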